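/- Fix integers $D\ge 0$ and $k_{\mathrm{IJ}}\ge 0$. Let $g_0,g_1,g_2,\dots:\mathbb R^D\to\mathbb R^D$ be random functions. For $N\ge 1$, $\theta\in\mathbb R^D$, $w\in\mathbb R^N$ put $$G_N(\theta,w)=\frac1N\Big(g_0(\theta)+\sum_{n=1}^N w_n g_n(\theta)\Big),$$ and let $1_N$ be the all-ones vector and $w_{(-n)}\in\mathbb R^N$ the leave-one-out weight vector with $n$-th entry $0$ and all other entries $1$. Write $\hat\theta_N(\tilde w)$ for the chosen solution of $G_N(\theta,\tilde w)=0$, and for $N\ge1$, $1\le n\le N$ let $\Omega_{N,n}\subseteq\mathbb R^D$ be a domain (possibly the same set for all $N,n$). Suppose that, with probability one, there are constants $C>0$ and $M_1,\dots,M_{k_{\mathrm{IJ}}+1}$, independent of $N$ and $n$, such that for all $N\ge1$ and $1\le n\le N$, with $w=w_{(-n)}$: 1. $\Omega_{N,n}$ is open and, for some $\varepsilon,\epsilon>0$ (which may depend on $N,n$), with $$\Omega_w=\{\tilde w\in\mathbb R^N:\ \|\tilde w-((1-t)1_N+tw)\|_2<\varepsilon\text{ for some }t\in[0,1]\},$$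 we have $G_N(\hat\theta_N(\tilde w),\tilde w)=0$ for all $\tilde w\in\Omega_w$, and $\Omega_{N,n}$ contains every point at distance less than $\epsilon$ from the convex hull of $\{\hat\theta_N(\tilde w):\tilde w\in\Omega_w\}$. 2. $g_0,\dots,g_N$ are $k_{\mathrm{IJ}}+1$ times continuously differentiable on $\Omega_{N,n}$. 3. $H(\theta)=\partial G_N(\theta,1_N)/\partial\theta$ is strongly positive definite, uniformly on $\Omega_{N,n}$: $v^{T}H(\theta)v\ge C^{-1}\|v\|_2^2$ for all $\theta\in\Omega_{N,n}$, $v\in\mathbb R^D$. (For symmetric $H(\theta)$ this means that $H(\theta)$ is positive definite with $\|H(\theta)^{-1}\|_{op}\le C$.) 4. For $1\le k\le k_{\mathrm{IJ}}+1$ and $\theta\in\Omega_{N,n}$, the array of all $k$-th order partial derivatives of $G_N(\cdot,1_N)$ at $\theta$ has $L_2$ (Frobenius) norm at most $M_k$. Suppose also that, with probability one, for each $0\le k\le k_{\mathrm{IJ}}+1$ the $k$-th order partial derivatives of the per-datum functions are uniformly bounded: the entries of the arrays of $k$-th derivatives of $g_m$ at $\theta$ are bounded in absolute value by a finite constant $T_k$,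 uniformly over all $N\ge1$, $1\le n\le N$, $\theta\in\Omega_{N,n}$ and $1\le m\le N$ (if all $\Omega_{N,n}$ equal one set $\Omega_\theta$, this is $\sup_{m\ge1}\sup_{\theta\in\Omega_\theta}\|g_m^{(k)}(\theta)\|_\infty<\infty$). Then, with probability one, for all sufficiently large $N$ the function $\hat\theta_N$ is $k_{\mathrm{IJ}}$ times continuously differentiable at $1_N$, so that the $k_{\mathrm{IJ}}$-th order infinitesimal jackknife $$\hat\theta^{\mathrm{IJ}}_{N}(w)=\hat\theta_N(1_N)+\sum_{k=1}^{k_{\mathrm{IJ}}}\frac1{k!}\,D^k\hat\theta_N(1_N)[w-1_N,\dots,w-1_N]$$ is defined, and $$\max_{1\le n\le N}\big\|\hat\theta^{\mathrm{IJ}}_{N}(w_{(-n)})-\hat\theta_N(w_{(-n)})\big\|_2=O\big(N^{-(k_{\mathrm{IJ}}+1)}\big)\qquad(N\to\infty).$$ -/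

import Mathlib

open Filter Topology MeasureTheory Asymptotics

namespace HOIJ

/-- The parameter space `ℝ^D` with its Euclidean norm. -/
abbrev Param (D : ℕ) := EuclideanSpace ℝ (Fin D)

/-- Weight vectors of length `N`, with the Euclidean norm. The coordinate `i : Fin N` of a weight
vector is the weight of the datum number `i + 1`. -/
abbrev Weight (N : ℕ) := EuclideanSpace ℝ (Fin N)

/-- The all-ones weight vector `1_N`. -/
noncomputable def ones (N : ℕ) : Weight N := WithLp.toLp 2 fun _ => 1

/-- The leave-one-out weight vector: `0` at index `i` and `1` at all other indices. -/
noncomputable def loo {N : ℕ} (i : Fin N) : Weight N :=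
  WithLp.toLp 2 fun j => if j = i then 0 else 1

/-- The estimating function
`G(θ, w) = (1 / N) (g_0(θ) + ∑_{n = 1}^N w_n g_n(θ))`. -/
noncomputable def G {D : ℕ} (g : ℕ → Param D → Param D) (N : ℕ) (θ : Param D) (w : Weight N) :
    Param D :=
  (1 / (N : ℝ)) • (g 0 θ + ∑ i : Fin N, w i • g ((i : ℕ) + 1) θ)

/-- The array of all `k`-th order partial derivatives
`∂^k f_c / ∂θ_{d 0} … ∂θ_{d (k - 1)}` of `f` at `θ`. -/
noncomputable def derivArray {D : ℕ} (k : ℕ) (f : Param D → Param D) (θ : Param D) :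
    (Fin k → Fin D) × Fin D → ℝ :=
  fun p => (iteratedFDeriv ℝ k f θ fun j => EuclideanSpace.single (p.1 j) (1 : ℝ)) p.2

/-- The `L_2` norm of an array: the root of the sum of the squares of all its entries. -/
noncomputable def norm2 {ι : Type*} [Fintype ι] (a : ι → ℝ) : ℝ := √(∑ p, a p ^ 2)

/-- The `L_∞` norm of an array: its largest absolute entry (the sup norm of `ι → ℝ`). -/
noncomputable def normInf {ι : Type*} [Fintype ι] (a : ι → ℝ) : ℝ := ‖a‖

/-- The open `ε`-tube `Ω_w` around the segment that joins `1_N` to `w`. -/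
def tube {N : ℕ} (w : Weight N) (ε : ℝ) : Set (Weight N) :=
  {w' | ∃ t ∈ Set.Icc (0 : ℝ) 1, ‖w' - ((1 - t) • ones N + t • w)‖ < ε}

/-- Domain assumption for the weight vector `w`: for all weights `w'` in some tube `Ω_w`, the value
`θhat w'` solves `G(θ, w') = 0`, and the open set `Θ` contains an enlargement of the convex hull of
the set of these solutions. -/
def DomainAssumption {D N : ℕ} (g : ℕ → Param D → Param D) (θhat : Weight N → Param D)
    (w : Weight N) (Θ : Set (Param D)) : Prop :=
  IsOpen Θ ∧ ∃ ε > 0, (∀ w' ∈ tube w ε, G g N (θhat w') w' = 0) ∧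
    ∃ η > 0, {θ | ∃ θ' ∈ convexHull ℝ (θhat '' tube w ε), ‖θ - θ'‖ < η} ⊆ Θ

/-- Smoothness assumption: `g_0, …, g_N` are `K + 1` times continuously differentiable on `Θ`. -/
def SmoothAssumption {D : ℕ} (K N : ℕ) (g : ℕ → Param D → Param D) (Θ : Set (Param D)) : Prop :=
  ∀ n ≤ N, ContDiffOn ℝ ((K + 1 : ℕ) : WithTop ℕ∞) (g n) Θ

/-- Strong positive definiteness on `Θ` of `H(θ, 1_N)`, the matrix of first derivatives of
`G(·, 1_N)`, with constant `C`: `vᵀ H(θ, 1_N) v ≥ C⁻¹ ‖v‖²`. It implies that `H(θ, 1_N)` is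
invertible with `‖H(θ, 1_N)⁻¹‖_op ≤ C`, and when `H(θ, 1_N)` is symmetric it says exactly that
`H(θ, 1_N)` is positive definite with `‖H(θ, 1_N)⁻¹‖_op ≤ C`. -/
def ConvexityAssumption {D : ℕ} (N : ℕ) (g : ℕ → Param D → Param D) (Θ : Set (Param D))
    (C : ℝ) : Prop :=
  ∀ θ ∈ Θ, ∀ v : Param D,
    C⁻¹ * ‖v‖ ^ 2 ≤ inner ℝ v (fderiv ℝ (fun θ' => G g N θ' (ones N)) θ v)

/-- Boundedness assumption: the arrays of `k`-th derivatives of `G(·, 1_N)`, `1 ≤ k ≤ K + 1`, have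
`L_2` norm at most `M k` on `Θ`. -/
def BoundedAssumption {D : ℕ} (K N : ℕ) (g : ℕ → Param D → Param D) (Θ : Set (Param D))
    (M : ℕ → ℝ) : Prop :=
  ∀ k, 1 ≤ k → k ≤ K + 1 → ∀ θ ∈ Θ,
    norm2 (derivArray k (fun θ' => G g N θ' (ones N)) θ) ≤ M k

/-- The four assumptions hold for all `N ≥ 1` and all leave-one-out weights, with the domain
`Θ N i` for the weight that leaves out the `i`-th datum, and with constants `C` and `M k` that
depend neither on `N` nor on the weight. -/
def UniformAssumptions {D : ℕ} (K : ℕ) (g : ℕ → Param D → Param D)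
    (θhat : (N : ℕ) → Weight N → Param D) (Θ : (N : ℕ) → Fin N → Set (Param D)) : Prop :=
  ∃ C > 0, ∃ M : ℕ → ℝ, ∀ N : ℕ, 1 ≤ N → ∀ i : Fin N,
    DomainAssumption g (θhat N) (loo i) (Θ N i) ∧
    SmoothAssumption K N g (Θ N i) ∧
    ConvexityAssumption N g (Θ N i) C ∧
    BoundedAssumption K N g (Θ N i) M

/-- For each `0 ≤ k ≤ K + 1`, the sup norms of the `k`-th derivatives of the per-datum functions
`g_n`, `n ≥ 1`, are bounded over the domains, uniformly in `n` (and in the domain). When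
all domains `Θ N i` are one set, this is `sup_{n ≥ 1} sup_θ ‖g_n^{(k)}(θ)‖_∞ < ∞`. -/
def SupTermsBounded {D : ℕ} (K : ℕ) (g : ℕ → Param D → Param D)
    (Θ : (N : ℕ) → Fin N → Set (Param D)) : Prop :=
  ∀ k ≤ K + 1, ∃ T : ℝ, ∀ (N : ℕ) (i : Fin N), ∀ θ ∈ Θ N i, ∀ n, 1 ≤ n → n ≤ N →
    normInf (derivArray k (g n) θ) ≤ T

/-- The `K`-th order infinitesimal jackknife: the `K`-th order Taylor polynomial of `θhat` centred
at `1_N` and evaluated at `w`. -/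
noncomputable def thetaIJ {D N : ℕ} (K : ℕ) (θhat : Weight N → Param D) (w : Weight N) :
    Param D :=
  θhat (ones N) + ∑ k ∈ Finset.Icc 1 K,
    (1 / (k.factorial : ℝ)) • iteratedFDeriv ℝ k θhat (ones N) fun _ => w - ones N

/-- The error `‖θ_K^{IJ}(w) - θhat(w)‖_2`. -/
noncomputable def errIJ {D N : ℕ} (K : ℕ) (θhat : Weight N → Param D) (w : Weight N) : ℝ :=
  ‖thetaIJ K θhat w - θhat w‖

end HOIJ

/-! On the segment from the all-ones vector to the weight leaving out datum n, written `ones N + s •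
looDir i` with 0 ≤ s ≤ 1/N, the solution ψ(s) satisfies F(ψ) = s h(ψ), where F = G_N(·, 1_N) and h =
g_n (`G_line`). Rescaling the direction by N removes the factor 1/N, so F and h have derivatives
bounded uniformly in N and n.

Differentiating gives (F' - s h') ψ' = h. As s ≤ 1/N, strong positivity of F' survives the
perturbation for large N (`ConvexityAssumption.perturb`), and induction on the order bounds all
derivatives of ψ up to order K + 1 by constants independent of N, n and s
(`UnifDerivBounded.of_implicit`). The jackknife is the Taylor polynomial of ψ at 0, evaluated at
1/N, so the remainder is O(N^{-(K+1)}) (`errIJ_loo_le`).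

Not even continuity of `θhat` is assumed: strong monotonicity on the convex hull of the solutions
gives a Lipschitz estimate, and the implicit function theorem then gives smoothness
(`contDiffAt_solution`). -/

namespace HOIJ

/-! ### Calculus of derivative bounds uniform over a family -/

section UniformDerivatives

variable {ι E F F' H : Type*} [NormedAddCommGroup E] [NormedSpace ℝ E]
  [NormedAddCommGroup F] [NormedSpace ℝ F] [NormedAddCommGroup F'] [NormedSpace ℝ F']
  [NormedAddCommGroup H] [NormedSpace ℝ H]

/-- Each `f i` is `n` times continuously differentiable at `x i`, and the derivatives of orders
`m, …, n` of `f i` at `x i` are bounded uniformly in `i`. -/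
def UnifDerivBounded (m n : ℕ) (f : ι → E → F) (x : ι → E) : Prop :=
  (∀ i, ContDiffAt ℝ n (f i) (x i)) ∧
    ∀ k, m ≤ k → k ≤ n → ∃ B, ∀ i, ‖iteratedFDeriv ℝ k (f i) (x i)‖ ≤ B

lemma exists_isOpen_contDiffOn {n : ℕ} {f : E → F} {x : E} (hf : ContDiffAt ℝ n f x) :
    ∃ u, IsOpen u ∧ x ∈ u ∧ ContDiffOn ℝ n f u :=
  ⟨interior {y | ContDiffAt ℝ n f y}, isOpen_interior,
    mem_interior_iff_mem_nhds.2 (hf.eventually (by simp)),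
    fun _ hy => ContDiffAt.contDiffWithinAt (Set.mem_ofPred_eq.mp (interior_subset hy))⟩

/-- The Faà di Bruno estimate on sets, localised to open neighbourhoods where both functions are
smooth. -/
lemma norm_iteratedFDeriv_comp_le_of_contDiffAt {n : ℕ} {g : F → H} {f : E → F} {x : E}
    (hg : ContDiffAt ℝ n g (f x)) (hf : ContDiffAt ℝ n f x) {C D : ℝ}
    (hC : ∀ i ≤ n, ‖iteratedFDeriv ℝ i g (f x)‖ ≤ C)
    (hD : ∀ i, 1 ≤ i → i ≤ n → ‖iteratedFDeriv ℝ i f x‖ ≤ D ^ i) :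
    ‖iteratedFDeriv ℝ n (g ∘ f) x‖ ≤ n.factorial * C * D ^ n := by
  obtain ⟨t, ht, hxt, hgt⟩ := exists_isOpen_contDiffOn hg
  obtain ⟨u, hu, hxu, hfu⟩ := exists_isOpen_contDiffOn hf
  have hs : IsOpen (u ∩ f ⁻¹' t) := hfu.continuousOn.isOpen_inter_preimage hu ht
  have hx : x ∈ u ∩ f ⁻¹' t := ⟨hxu, hxt⟩
  rw [← iteratedFDerivWithin_of_isOpen n hs hx]
  refine norm_iteratedFDerivWithin_comp_le hgt (hfu.mono Set.inter_subset_left) le_rfl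
    ht.uniqueDiffOn hs.uniqueDiffOn (fun y hy => hy.2) hx (fun i hi => ?_) fun i h1 hi => ?_
  · rw [iteratedFDerivWithin_of_isOpen i ht hxt]
    exact hC i hi
  · rw [iteratedFDerivWithin_of_isOpen i hs hx]
    exact hD i h1 hi

lemma norm_iteratedFDeriv_bilinear_le_of_contDiffAt (B : F →L[ℝ] F' →L[ℝ] H) {n : ℕ} {f : E → F}
    {g : E → F'} {x : E} (hf : ContDiffAt ℝ n f x) (hg : ContDiffAt ℝ n g x) :
    ‖iteratedFDeriv ℝ n (fun y => B (f y) (g y)) x‖ ≤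
      ‖B‖ * ∑ i ∈ Finset.range (n + 1), (n.choose i : ℝ) * ‖iteratedFDeriv ℝ i f x‖ *
        ‖iteratedFDeriv ℝ (n - i) g x‖ := by
  obtain ⟨t, ht, hxt, hft⟩ := exists_isOpen_contDiffOn hf
  obtain ⟨u, hu, hxu, hgu⟩ := exists_isOpen_contDiffOn hg
  have hs : IsOpen (t ∩ u) := ht.inter hu
  have hx : x ∈ t ∩ u := ⟨hxt, hxu⟩
  have := B.norm_iteratedFDerivWithin_le_of_bilinear (hft.mono Set.inter_subset_left)
    (hgu.mono Set.inter_subset_right) hs.uniqueDiffOn hx le_rfl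
  simpa only [iteratedFDerivWithin_of_isOpen _ hs hx] using this

namespace UnifDerivBounded

variable {m n : ℕ} {f : ι → E → F} {x : ι → E}

lemma mono (h : UnifDerivBounded m n f x) {m' n' : ℕ} (hm : m ≤ m') (hn : n' ≤ n) :
    UnifDerivBounded m' n' f x :=
  ⟨fun i => (h.1 i).of_le (by exact_mod_cast hn),
    fun k h1 h2 => h.2 k (hm.trans h1) (h2.trans hn)⟩

lemma congr (h : UnifDerivBounded m n f x) {g : ι → E → F}
    (hg : ∀ i, g i =ᶠ[𝓝 (x i)] f i) : UnifDerivBounded m n g x := by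
  refine ⟨fun i => (h.1 i).congr_of_eventuallyEq (hg i), fun k h1 h2 => ?_⟩
  obtain ⟨B, hB⟩ := h.2 k h1 h2
  exact ⟨B, fun i => by rw [((hg i).iteratedFDeriv ℝ k).eq_of_nhds]; exact hB i⟩

lemma exists_bound (h : UnifDerivBounded m n f x) :
    ∃ B, 1 ≤ B ∧ ∀ i k, m ≤ k → k ≤ n → ‖iteratedFDeriv ℝ k (f i) (x i)‖ ≤ B := by
  choose! B hB using h.2
  refine ⟨1 + ∑ k ∈ Finset.range (n + 1), |B k|,
    le_add_of_nonneg_right (Finset.sum_nonneg fun _ _ => abs_nonneg _), fun i k h1 h2 => ?_⟩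
  have := Finset.single_le_sum (f := fun k => |B k|) (fun _ _ => abs_nonneg _)
    (Finset.mem_range.2 (Nat.lt_succ_of_le h2))
  linarith [hB k h1 h2 i, le_abs_self (B k)]

/-- The chain rule sees only derivatives of the inner function of order at least 1. This is why the
lower order m is recorded: the solutions themselves need not be bounded. -/
lemma comp {g : ι → F → H} (hg : UnifDerivBounded 0 n g fun i => f i (x i))
    (hf : UnifDerivBounded 1 n f x) : UnifDerivBounded 0 n (fun i => g i ∘ f i) x := by
  refine ⟨fun i => (hg.1 i).comp _ (hf.1 i), fun k _ hk => ?_⟩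
  obtain ⟨C, -, hC⟩ := hg.exists_bound
  obtain ⟨D, h1D, hD⟩ := hf.exists_bound
  refine ⟨k.factorial * C * D ^ k, fun i => ?_⟩
  refine norm_iteratedFDeriv_comp_le_of_contDiffAt ((hg.mono le_rfl hk).1 i)
    ((hf.mono le_rfl hk).1 i) (fun j hj => hC i j (Nat.zero_le _) (hj.trans hk))
    -- The Faà di Bruno bound wants D ^ j; since 1 ≤ D, a common bound D suffices.
    fun j h1 hj => (hD i j h1 (hj.trans hk)).trans (le_self_pow₀ h1D (by lia))

lemma bilinear (B : F →L[ℝ] F' →L[ℝ] H) {g : ι → E → F'} (hf : UnifDerivBounded 0 n f x)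
    (hg : UnifDerivBounded 0 n g x) :
    UnifDerivBounded 0 n (fun i y => B (f i y) (g i y)) x := by
  refine ⟨fun i => B.isBoundedBilinearMap.contDiff.contDiffAt.comp₂ (hf.1 i) (hg.1 i),
    fun k _ hk => ?_⟩
  obtain ⟨C, hC1, hC⟩ := hf.exists_bound
  obtain ⟨D, hD1, hD⟩ := hg.exists_bound
  refine ⟨‖B‖ * ∑ i ∈ Finset.range (k + 1), (k.choose i : ℝ) * C * D, fun i => ?_⟩
  refine (norm_iteratedFDeriv_bilinear_le_of_contDiffAt B ((hf.mono le_rfl hk).1 i)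
    ((hg.mono le_rfl hk).1 i)).trans ?_
  gcongr with j hj
  · exact hC i j (Nat.zero_le _) ((Nat.lt_succ_iff.1 (Finset.mem_range.1 hj)).trans hk)
  · exact hD i _ (Nat.zero_le _) ((Nat.sub_le _ _).trans hk)

lemma sub {g : ι → E → F} (hf : UnifDerivBounded m n f x) (hg : UnifDerivBounded m n g x) :
    UnifDerivBounded m n (fun i => f i - g i) x := by
  refine ⟨fun i => (hf.1 i).sub (hg.1 i), fun k h1 hk => ?_⟩
  obtain ⟨C, hC⟩ := hf.2 k h1 hk
  obtain ⟨D, hD⟩ := hg.2 k h1 hk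
  refine ⟨C + D, fun i => ?_⟩
  rw [iteratedFDeriv_sub_apply ((hf.mono le_rfl hk).1 i) ((hg.mono le_rfl hk).1 i)]
  exact (norm_sub_le _ _).trans (add_le_add (hC i) (hD i))

lemma fderiv (hf : UnifDerivBounded (m + 1) (n + 1) f x) :
    UnifDerivBounded m n (fun i => fderiv ℝ (f i)) x := by
  refine ⟨fun i => (hf.1 i).fderiv_right (by norm_cast), fun k h1 hk => ?_⟩
  simpa only [norm_iteratedFDeriv_fderiv] using hf.2 (k + 1) (by lia) (by lia)

lemma of_deriv {f : ι → ℝ → F} {x : ι → ℝ} (hf : ∀ i, ContDiffAt ℝ (n + 1 : ℕ) (f i) (x i))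
    (h : UnifDerivBounded 0 n (fun i => deriv (f i)) x) : UnifDerivBounded 1 (n + 1) f x := by
  refine ⟨hf, fun k h1 hk => ?_⟩
  obtain ⟨k, rfl⟩ := Nat.exists_eq_add_of_le' h1
  simpa only [norm_iteratedFDeriv_eq_norm_iteratedDeriv, iteratedDeriv_succ'] using
    h.2 k (Nat.zero_le _) (by lia)

lemma id_of_bounded {x : ι → ℝ} {B : ℝ} (hx : ∀ i, |x i| ≤ B) (n : ℕ) :
    UnifDerivBounded 0 n (fun _ s => s) x := by
  refine ⟨fun i => contDiffAt_id, fun k _ _ => ⟨max B 1, fun i => ?_⟩⟩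
  rw [norm_iteratedFDeriv_eq_norm_iteratedDeriv]
  match k with
  | 0 => simp [hx i]
  | 1 => simp [iteratedDeriv_one]
  | k + 2 =>
    have : deriv (fun s : ℝ => s) = fun _ => 1 := by ext; simp
    rw [iteratedDeriv_succ', this, iteratedDeriv_const]
    simp

end UnifDerivBounded

/-! ### Uniform inversion and the implicit equation F(ψ) = s h(ψ) -/

section Inverse

variable [FiniteDimensional ℝ E]

lemma isUnit_of_norm_le {C : ℝ} {L : E →L[ℝ] E} (hL : ∀ v, ‖v‖ ≤ C * ‖L v‖) : IsUnit L := by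
  have hinj : Function.Injective L := (injective_iff_map_eq_zero L).2 fun v hv => by
    simpa [hv] using hL v
  rw [ContinuousLinearMap.isUnit_iff_bijective]
  exact ⟨hinj, (LinearMap.injective_iff_surjective (f := (L : E →ₗ[ℝ] E))).1 hinj⟩

/-- In finite dimension all the L i lie in one compact set of invertible operators, on which each
derivative of inversion is continuous and hence bounded. -/
lemma UnifDerivBounded.ringInverse {M C : ℝ} {L : ι → E →L[ℝ] E} (hM : ∀ i, ‖L i‖ ≤ M)
    (hL : ∀ i v, ‖v‖ ≤ C * ‖L i v‖) (n : ℕ) :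
    UnifDerivBounded 0 n (fun _ => Ring.inverse) L := by
  have hu : ∀ L : E →L[ℝ] E, (∀ v, ‖v‖ ≤ C * ‖L v‖) → ∀ k : ℕ,
      ContDiffAt ℝ k (Ring.inverse : (E →L[ℝ] E) → E →L[ℝ] E) L := fun L hL k => by
    obtain ⟨u, rfl⟩ := isUnit_of_norm_le hL
    exact contDiffAt_ringInverse ℝ u
  refine ⟨fun i => hu _ (hL i) n, fun k _ _ => ?_⟩
  have hclosed : IsClosed {L : E →L[ℝ] E | ∀ v, ‖v‖ ≤ C * ‖L v‖} := by
    simp only [Set.ofPred_forall]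
    exact isClosed_iInter fun v => isClosed_le continuous_const (by fun_prop)
  have : ProperSpace (E →L[ℝ] E) := FiniteDimensional.proper_real _
  have hcpt := (isCompact_closedBall (0 : E →L[ℝ] E) M).inter_right hclosed
  obtain ⟨B, hB⟩ := hcpt.exists_bound_of_continuousOn
    (f := iteratedFDeriv ℝ k (Ring.inverse : (E →L[ℝ] E) → E →L[ℝ] E)) fun L hL' =>
      ((hu L hL'.2 k).iteratedFDeriv_right (m := 0) (by simp)).continuousAt.continuousWithinAt
  exact ⟨B, fun i => hB _ ⟨by simpa using hM i, hL i⟩⟩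

/-- If `F (ψ s) = s • h (ψ s)` near `s = x`, the derivatives of `ψ` at `x` are bounded in terms of
the derivatives of `F` and `h` at `ψ x` and of the inverse of `F' - x h'` there. -/
theorem UnifDerivBounded.of_implicit {F h : ι → E → E} {ψ : ι → ℝ → E} {x : ι → ℝ} {C R : ℝ}
    {K : ℕ} (hψ : ∀ i, ContDiffAt ℝ (K + 1 : ℕ) (ψ i) (x i))
    (hF : UnifDerivBounded 1 (K + 1) F fun i => ψ i (x i))
    (hh : UnifDerivBounded 0 (K + 1) h fun i => ψ i (x i))
    (hx : ∀ i, |x i| ≤ R)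
    (heq : ∀ i, ∀ᶠ s in 𝓝 (x i), F i (ψ i s) = s • h i (ψ i s))
    (hinv : ∀ i v, ‖v‖ ≤
      C * ‖(_root_.fderiv ℝ (F i) (ψ i (x i)) - x i • _root_.fderiv ℝ (h i) (ψ i (x i))) v‖) :
    UnifDerivBounded 1 (K + 1) ψ x := by
  have hF' := hF.fderiv
  have hh' := (hh.mono (Nat.zero_le 1) le_rfl).fderiv
  have hid := UnifDerivBounded.id_of_bounded hx K
  let A : ι → ℝ → E →L[ℝ] E := fun i =>
    -- The operator that multiplies ψ' in the differentiated equation.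
    (_root_.fderiv ℝ (F i) ∘ ψ i) - fun s => s • (_root_.fderiv ℝ (h i) ∘ ψ i) s
  have hA : ∀ n ≤ K, UnifDerivBounded 1 n ψ x → UnifDerivBounded 0 n A x := fun n hn H =>
    ((hF'.mono le_rfl hn).comp H).sub
      ((hid.mono le_rfl hn).bilinear (ContinuousLinearMap.lsmul ℝ ℝ)
        ((hh'.mono le_rfl hn).comp H))
  have h0 : UnifDerivBounded 1 0 ψ x :=
    ⟨fun i => (hψ i).of_le (by simp), fun k h1 h2 => by lia⟩
  obtain ⟨M, hM⟩ := (hA 0 (Nat.zero_le _) h0).2 0 le_rfl le_rfl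
  have hinv' := UnifDerivBounded.ringInverse (L := fun i => A i (x i)) (M := M) (C := C)
    (fun i => by simpa using hM i) hinv K
  -- Differentiating the equation and solving for ψ' gives ψ' = A⁻¹ h(ψ), whose right side involves
  -- no derivative of ψ.
  have hderiv : ∀ i, deriv (ψ i) =ᶠ[𝓝 (x i)] fun s =>
      ContinuousLinearMap.apply ℝ E (h i (ψ i s)) ((Ring.inverse ∘ A i) s) := fun i => by
    have hcont : ContinuousAt (ψ i) (x i) := (hψ i).continuousAt
    have hK : ((K + 1 : ℕ) : WithTop ℕ∞) ≠ 0 := by simp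
    have e1 := (hψ i).eventually (by simp)
    have e2 := hcont.eventually ((hF.1 i).eventually (by simp))
    have e3 := hcont.eventually ((hh.1 i).eventually (by simp))
    have e4 : ∀ᶠ s in 𝓝 (x i), IsUnit (A i s) :=
      ((hA 0 (Nat.zero_le _) h0).1 i).continuousAt.eventually
        (Units.isOpen.mem_nhds (isUnit_of_norm_le (hinv i)))
    filter_upwards [e1, e2, e3, e4, (heq i).eventually_nhds] with s h1 h2 h3 h4 h5
    have d1 := (h1.differentiableAt hK).hasDerivAt
    have d2 := (h2.differentiableAt hK).hasFDerivAt.comp_hasDerivAt s d1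
    have d3 := (h3.differentiableAt hK).hasFDerivAt.comp_hasDerivAt s d1
    have d4 := d2.unique (((hasDerivAt_id s).smul d3).congr_of_eventuallyEq h5)
    have d5 : A i s (deriv (ψ i) s) = h i (ψ i s) := by
      simp only [id, one_smul, Function.comp_apply] at d4
      simp [A, d4]
    simp only [Function.comp_apply, ContinuousLinearMap.apply_apply, ← d5]
    rw [← mul_apply_eq_comp, Ring.inverse_mul_cancel _ h4]
    simp
  -- Bootstrap: bounds on ψ up to order n bound A⁻¹ h(ψ) up to order n, hence ψ up to order n + 1.
  -- F' and h' are available to order K, so the last order reached is K + 1.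
  have key : ∀ n ≤ K + 1, UnifDerivBounded 1 n ψ x := by
    intro n
    induction n with
    | zero => exact fun _ => h0
    | succ n ih =>
      intro hn
      have H := ih (by lia)
      have hn' : n ≤ K := by lia
      refine UnifDerivBounded.of_deriv (fun i => (hψ i).of_le (by exact_mod_cast hn)) ?_
      refine UnifDerivBounded.congr ?_ hderiv
      refine UnifDerivBounded.bilinear (ContinuousLinearMap.apply ℝ E)
        ((hh.mono le_rfl (by lia)).comp H) ?_
      exact (hinv'.mono le_rfl hn').comp ((hA n hn' H).mono (Nat.zero_le 1) le_rfl)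
  exact key _ le_rfl

end Inverse

end UniformDerivatives

/-! ### Regularity of implicit solutions, monotonicity, derivatives along lines -/

section Implicit

/-- A continuous solution of an implicit equation is as smooth as the equation. -/
lemma contDiffAt_of_implicit {E W : Type*} [NormedAddCommGroup E] [NormedSpace ℝ E]
    [FiniteDimensional ℝ E] [NormedAddCommGroup W] [NormedSpace ℝ W] [CompleteSpace W]
    {n : WithTop ℕ∞} (hn : n ≠ 0) {Φ : W × E → E} {θ : W → E} {w : W}
    (hΦ : ContDiffAt ℝ n Φ (w, θ w)) (hθ : ContinuousAt θ w)
    (heq : ∀ᶠ w' in 𝓝 w, Φ (w', θ w') = 0) {C : ℝ} {L : E →L[ℝ] E}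
    (hder : HasFDerivAt (fun e => Φ (w, e)) L (θ w)) (hL : ∀ v, ‖v‖ ≤ C * ‖L v‖) :
    ContDiffAt ℝ n θ w := by
  have : CompleteSpace E := FiniteDimensional.complete ℝ E
  have hcomp : fderiv ℝ Φ (w, θ w) ∘L .inr ℝ W E = L :=
    ((hΦ.differentiableAt hn).hasFDerivAt.comp (θ w) (hasFDerivAt_prodMk_right w (θ w))).unique hder
  have hinv : (fderiv ℝ Φ (w, θ w) ∘L .inr ℝ W E).IsInvertible := by
    rw [hcomp]
    obtain ⟨u, hu⟩ := isUnit_of_norm_le hL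
    exact ⟨ContinuousLinearEquiv.unitsEquiv ℝ E u, by ext v; rw [← hu]; rfl⟩
  refine (hΦ.contDiffAt_implicitFunction hn hinv).congr_of_eventuallyEq ?_
  have hpair : Tendsto (fun w' => (w', θ w')) (𝓝 w) (𝓝 (w, θ w)) :=
    (continuousAt_id.prodMk hθ)
  filter_upwards [hpair.eventually (hΦ.eventually_apply_eq_iff_implicitFunction hn hinv), heq]
    with w' h1 h2
  exact (h1.1 (h2.trans heq.self_of_nhds.symm)).symm

/-- Strong monotonicity on a segment from the lower bound on the derivative. -/
lemma mul_norm_sub_le_of_segment {E : Type*} [NormedAddCommGroup E] [InnerProductSpace ℝ E]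
    {f : E → E} {c : ℝ} {a b : E} (hf : ∀ x ∈ segment ℝ a b, DifferentiableAt ℝ f x)
    (hc : ∀ x ∈ segment ℝ a b, ∀ v, c * ‖v‖ ^ 2 ≤ inner ℝ v (fderiv ℝ f x v)) :
    c * ‖b - a‖ ≤ ‖f b - f a‖ := by
  rcases eq_or_ne b a with rfl | hne
  · simp
  have hpos : 0 < ‖b - a‖ := norm_pos_iff.2 (sub_ne_zero.2 hne)
  have hmem : ∀ r ∈ Set.Icc (0 : ℝ) 1, a + r • (b - a) ∈ segment ℝ a b := fun r hr => by
    rw [segment_eq_image']; exact ⟨r, hr, rfl⟩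
  have hd : ∀ r ∈ Set.Icc (0 : ℝ) 1, HasDerivAt (fun r : ℝ => inner ℝ (b - a) (f (a + r • (b - a))))
      (inner ℝ (b - a) (fderiv ℝ f (a + r • (b - a)) (b - a))) r := fun r hr => by
    have h1 : HasDerivAt (fun r : ℝ => a + r • (b - a)) (b - a) r := by
      simpa using ((hasDerivAt_id r).smul_const (b - a)).const_add a
    have h2 := (hf _ (hmem r hr)).hasFDerivAt.comp_hasDerivAt r h1
    exact (innerSL ℝ (b - a)).hasFDerivAt.comp_hasDerivAt r h2
  -- Pairing with b - a makes the function scalar, so the mean value theorem applies.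
  obtain ⟨r, hr, hr'⟩ := exists_hasDerivAt_eq_slope _ _ (zero_lt_one' ℝ)
    (fun r hr => (hd r hr).continuousAt.continuousWithinAt)
    (fun r hr => hd r (Set.Ioo_subset_Icc_self hr))
  have h1 := hc _ (hmem r (Set.Ioo_subset_Icc_self hr)) (b - a)
  rw [hr'] at h1
  simp only [one_smul, add_sub_cancel, zero_smul, add_zero, sub_zero, div_one,
    ← inner_sub_right] at h1
  have h2 := real_inner_le_norm (b - a) (f b - f a)
  refine le_of_mul_le_mul_left ?_ hpos
  linarith [h1.trans h2, sq ‖b - a‖, mul_left_comm c ‖b - a‖ ‖b - a‖]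

lemma norm_le_of_inner {E : Type*} [NormedAddCommGroup E] [InnerProductSpace ℝ E] {c : ℝ}
    (hc : 0 < c) {L : E →L[ℝ] E} (hL : ∀ v, c * ‖v‖ ^ 2 ≤ inner ℝ v (L v)) (v : E) :
    ‖v‖ ≤ c⁻¹ * ‖L v‖ := by
  rcases eq_or_ne v 0 with rfl | hne
  · simp
  have hpos : 0 < ‖v‖ := norm_pos_iff.2 hne
  have h := (hL v).trans (real_inner_le_norm v (L v))
  rw [inv_mul_eq_div, le_div_iff₀ hc]
  refine le_of_mul_le_mul_left ?_ hpos
  linarith [sq ‖v‖, mul_left_comm c ‖v‖ ‖v‖, mul_comm ‖v‖ c]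

/-- The iterated derivatives of a function along a line. -/
lemma iteratedDeriv_line {E F : Type*} [NormedAddCommGroup E] [NormedSpace ℝ E]
    [NormedAddCommGroup F] [NormedSpace ℝ F] {f : E → F} (a v : E) (k : ℕ) :
    ∀ t : ℝ, ContDiffAt ℝ k f (a + t • v) →
      iteratedDeriv k (fun t : ℝ => f (a + t • v)) t =
        iteratedFDeriv ℝ k f (a + t • v) fun _ => v := by
  induction k with
  | zero => intro t _; simp
  | succ k ih =>
    intro t ht
    have hline : HasDerivAt (fun t : ℝ => a + t • v) v t := by
      simpa using ((hasDerivAt_id t).smul_const v).const_add a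
    have hev : iteratedDeriv k (fun t : ℝ => f (a + t • v)) =ᶠ[𝓝 t] fun t =>
        iteratedFDeriv ℝ k f (a + t • v) fun _ => v := by
      filter_upwards [hline.continuousAt.eventually (ht.eventually (by simp))] with s hs
      exact ih s (hs.of_le (by norm_cast; lia))
    rw [iteratedDeriv_succ, hev.deriv_eq, iteratedFDeriv_succ_apply_left]
    have hd : DifferentiableAt ℝ (iteratedFDeriv ℝ k f) (a + t • v) :=
      ht.differentiableAt_iteratedFDeriv (by norm_cast; lia)
    have h1 := hd.hasFDerivAt.comp_hasDerivAt t hline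
    exact ((ContinuousMultilinearMap.apply ℝ (fun _ : Fin k => E) F
      fun _ => v).hasFDerivAt.comp_hasDerivAt t h1).deriv

end Implicit

/-! ### From entrywise bounds to operator norms -/

section Arrays

variable {D : ℕ}

/-- A multilinear map is bounded by the entries of its array of coefficients. -/
lemma opNorm_le_card_mul {k : ℕ} (m : ContinuousMultilinearMap ℝ (fun _ : Fin k => Param D) (Param D))
    {B : ℝ} (hB : ∀ (r : Fin k → Fin D) (c : Fin D),
      |(m fun j => EuclideanSpace.single (r j) (1 : ℝ)) c| ≤ B) :
    ‖m‖ ≤ Fintype.card (Fin k → Fin D) * (D * |B|) := by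
  refine m.opNorm_le_bound (by positivity) fun v => ?_
  have hv : v = fun j => ∑ d, v j d • EuclideanSpace.single d (1 : ℝ) := by
    ext j c
    simp [Finset.sum_apply, Pi.single_apply]
  have hsum : m v = ∑ r : Fin k → Fin D,
      (∏ j, v j (r j)) • m fun j => EuclideanSpace.single (r j) (1 : ℝ) := by
    conv_lhs => rw [hv]
    rw [m.map_sum]
    simp_rw [m.map_smul_univ]
  have hentry : ∀ r : Fin k → Fin D,
      ‖m fun j => EuclideanSpace.single (r j) (1 : ℝ)‖ ≤ D * |B| := fun r => by
    set y := m fun j => EuclideanSpace.single (r j) (1 : ℝ) with hy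
    have : y = ∑ c, y c • EuclideanSpace.single c (1 : ℝ) := by
      ext c
      simp [Finset.sum_apply, Pi.single_apply]
    rw [this]
    refine (norm_sum_le _ _).trans ?_
    refine (Finset.sum_le_card_nsmul _ _ |B| fun c _ => ?_).trans (by simp)
    rw [norm_smul]
    simpa using (hB r c).trans (le_abs_self B)
  rw [hsum]
  refine (norm_sum_le _ _).trans ?_
  refine (Finset.sum_le_card_nsmul _ _ ((∏ j, ‖v j‖) * (D * |B|)) fun r _ => ?_).trans (le_of_eq ?_)
  · rw [norm_smul, norm_prod]
    gcongr with j
    · exact PiLp.norm_apply_le (v j) (r j)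
    · exact hentry r
  · simp; ring

lemma norm_iteratedFDeriv_le_of_norm2 {k : ℕ} {f : Param D → Param D} {θ : Param D} {B : ℝ}
    (h : norm2 (derivArray k f θ) ≤ B) :
    ‖iteratedFDeriv ℝ k f θ‖ ≤ Fintype.card (Fin k → Fin D) * (D * |B|) := by
  refine opNorm_le_card_mul _ fun r c => (Real.abs_le_sqrt ?_).trans h
  exact Finset.single_le_sum (f := fun p => derivArray k f θ p ^ 2) (fun _ _ => sq_nonneg _)
    (Finset.mem_univ (r, c))

lemma norm_iteratedFDeriv_le_of_normInf {k : ℕ} {f : Param D → Param D} {θ : Param D} {B : ℝ}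
    (h : normInf (derivArray k f θ) ≤ B) :
    ‖iteratedFDeriv ℝ k f θ‖ ≤ Fintype.card (Fin k → Fin D) * (D * |B|) :=
  opNorm_le_card_mul _ fun r c => (norm_le_pi_norm (derivArray k f θ) (r, c)).trans h

end Arrays

/-! ### The leave-one-out segment for fixed N -/

section LeaveOneOut

variable {D N : ℕ} {g : ℕ → Param D → Param D}

lemma G_sub_G (θ : Param D) (w w' : Weight N) :
    G g N θ w - G g N θ w' = (1 / (N : ℝ)) • ∑ i : Fin N, (w i - w' i) • g ((i : ℕ) + 1) θ := by
  simp only [G, ← smul_sub, add_sub_add_left_eq_sub, ← Finset.sum_sub_distrib, sub_smul]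

/-- Each coordinate of w - w' is at most its norm, and the factor 1/N cancels the number of
summands. -/
lemma norm_G_sub_G_le {θ : Param D} {T : ℝ} (hT : ∀ i : Fin N, ‖g ((i : ℕ) + 1) θ‖ ≤ T)
    (w w' : Weight N) : ‖G g N θ w - G g N θ w'‖ ≤ T * ‖w - w'‖ := by
  rw [G_sub_G, norm_smul]
  rcases Nat.eq_zero_or_pos N with rfl | hN
  · simp [Subsingleton.elim w w']
  have hN' : (0 : ℝ) < N := by exact_mod_cast hN
  have h : ‖∑ i : Fin N, (w i - w' i) • g ((i : ℕ) + 1) θ‖ ≤ N * (T * ‖w - w'‖) := by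
    refine (norm_sum_le _ _).trans ?_
    refine (Finset.sum_le_card_nsmul _ _ (T * ‖w - w'‖) fun i _ => ?_).trans (by simp)
    rw [norm_smul, mul_comm]
    have := PiLp.norm_apply_le (w - w') i
    exact mul_le_mul (hT i) this (norm_nonneg _) ((norm_nonneg _).trans (hT i))
  calc ‖1 / (N : ℝ)‖ * ‖∑ i : Fin N, (w i - w' i) • g ((i : ℕ) + 1) θ‖
      ≤ ‖1 / (N : ℝ)‖ * (N * (T * ‖w - w'‖)) := by gcongr
    _ = T * ‖w - w'‖ := by
      rw [Real.norm_of_nonneg (by positivity)]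
      field_simp

lemma contDiffAt_G {n : WithTop ℕ∞} {θ : Param D} (hg : ∀ m ≤ N, ContDiffAt ℝ n (g m) θ)
    (w : Weight N) : ContDiffAt ℝ n (fun p : Weight N × Param D => G g N p.2 p.1) (w, θ) := by
  have h : ∀ m ≤ N, ContDiffAt ℝ n (fun p : Weight N × Param D => g m p.2) (w, θ) :=
    fun m hm => (hg m hm).comp (w, θ) contDiffAt_snd
  refine ((h 0 (Nat.zero_le _)).add (ContDiffAt.sum fun i _ => ?_)).const_smul (1 / (N : ℝ))
  have hcoord : ContDiffAt ℝ n (fun p : Weight N × Param D => p.1 i) (w, θ) :=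
    (EuclideanSpace.proj (𝕜 := ℝ) i).contDiff.contDiffAt.comp (w, θ) contDiffAt_fst
  exact hcoord.smul (h _ i.2)

lemma contDiffAt_G_left {n : WithTop ℕ∞} {θ : Param D} (hg : ∀ m ≤ N, ContDiffAt ℝ n (g m) θ)
    (w : Weight N) : ContDiffAt ℝ n (fun θ' => G g N θ' w) θ :=
  (contDiffAt_G hg w).comp θ (contDiffAt_const.prodMk contDiffAt_id)

/-- The direction `N (w - 1_N)` from the all-ones vector to the leave-one-out vector `w`. -/
noncomputable def looDir (i : Fin N) : Weight N := (N : ℝ) • (loo i - ones N)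

lemma looDir_apply (i j : Fin N) : looDir i j = if j = i then -(N : ℝ) else 0 := by
  by_cases h : j = i <;> simp [looDir, loo, ones, h]

lemma G_line (i : Fin N) (s : ℝ) (θ : Param D) :
    G g N θ (ones N + s • looDir i) = G g N θ (ones N) - s • g ((i : ℕ) + 1) θ := by
  have hN : (N : ℝ) ≠ 0 := by exact_mod_cast i.pos.ne'
  have h := G_sub_G (g := g) θ (ones N + s • looDir i) (ones N)
  simp only [PiLp.add_apply, PiLp.smul_apply, looDir_apply, add_sub_cancel_left, smul_eq_mul,
    mul_ite, mul_zero, ite_smul, zero_smul, Finset.sum_ite_eq',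
    Finset.mem_univ, if_true, smul_smul] at h
  rw [sub_eq_iff_eq_add.1 h, sub_eq_add_neg, add_comm, ← neg_smul]
  congr 2
  field_simp

/-- The point with parameter s is the point t = s N of the tube's central segment, so its ε-ball
lies in the tube. -/
lemma tube_mem_nhds (i : Fin N) {s : ℝ} (hs : s ∈ Set.Icc 0 (1 / (N : ℝ))) {ε : ℝ} (hε : 0 < ε) :
    tube (loo i) ε ∈ 𝓝 (ones N + s • looDir i) := by
  have hN : (0 : ℝ) < N := by exact_mod_cast i.pos
  refine mem_of_superset (Metric.ball_mem_nhds _ hε) fun w hw => ⟨s * N, ⟨?_, ?_⟩, ?_⟩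
  · exact mul_nonneg hs.1 hN.le
  · exact (le_div_iff₀ hN).1 hs.2
  · have : (1 - s * N) • ones N + (s * N) • loo i = ones N + s • looDir i := by
      rw [looDir, smul_smul]; module
    rw [this]
    exact mem_ball_iff_norm.1 hw

lemma DomainAssumption.convexHull_subset {θhat : Weight N → Param D} {w : Weight N}
    {Θ : Set (Param D)} (h : DomainAssumption g θhat w Θ) :
    ∃ ε > 0, (∀ w' ∈ tube w ε, G g N (θhat w') w' = 0) ∧
      convexHull ℝ (θhat '' tube w ε) ⊆ Θ := by
  obtain ⟨-, ε, hε, h0, η, hη, hsub⟩ := h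
  exact ⟨ε, hε, h0, fun θ hθ => hsub ⟨θ, hθ, by simpa using hη⟩⟩

lemma SmoothAssumption.contDiffAt {K : ℕ} {Θ : Set (Param D)} (h : SmoothAssumption K N g Θ)
    (hΘ : IsOpen Θ) {θ : Param D} (hθ : θ ∈ Θ) {n : ℕ} (hn : n ≤ N) :
    ContDiffAt ℝ (K + 1 : ℕ) (g n) θ :=
  (h n hn).contDiffAt (hΘ.mem_nhds hθ)

/-- For large `N`, the derivative of `G` stays strongly positive definite along the segment from
the all-ones vector to a leave-one-out vector. -/
lemma ConvexityAssumption.perturb {C T s : ℝ} {Θ : Set (Param D)}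
    (hconv : ConvexityAssumption N g Θ C) (hC : 0 < C) (i : Fin N)
    (hT : ∀ θ ∈ Θ, ‖fderiv ℝ (g ((i : ℕ) + 1)) θ‖ ≤ T) (hN : 2 * C * T ≤ N)
    (hs : s ∈ Set.Icc 0 (1 / (N : ℝ))) {θ : Param D} (hθ : θ ∈ Θ) (v : Param D) :
    (2 * C)⁻¹ * ‖v‖ ^ 2 ≤ inner ℝ v ((fderiv ℝ (fun θ' => G g N θ' (ones N)) θ -
      s • fderiv ℝ (g ((i : ℕ) + 1)) θ) v) := by
  have hN' : (0 : ℝ) < N := by exact_mod_cast i.pos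
  have h1 := hconv θ hθ v
  have hT0 : 0 ≤ T := (norm_nonneg _).trans (hT θ hθ)
  have h2 : inner ℝ v (fderiv ℝ (g ((i : ℕ) + 1)) θ v) ≤ T * ‖v‖ ^ 2 :=
    calc _ ≤ ‖v‖ * ‖fderiv ℝ (g ((i : ℕ) + 1)) θ v‖ := real_inner_le_norm _ _
      _ ≤ ‖v‖ * (T * ‖v‖) := by
        gcongr; exact (ContinuousLinearMap.le_opNorm _ _).trans (by gcongr; exact hT θ hθ)
      _ = T * ‖v‖ ^ 2 := by ring
  -- Since s ≤ 1/N and N ≥ 2CT, the perturbation costs at most half of the lower bound C⁻¹.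
  have h3 : s * T ≤ (2 * C)⁻¹ := by
    refine (mul_le_mul_of_nonneg_right hs.2 hT0).trans ?_
    rw [← one_div, one_div_mul_eq_div, div_le_div_iff₀ hN' (by positivity)]
    linarith
  have h4 : s * inner ℝ v (fderiv ℝ (g ((i : ℕ) + 1)) θ v) ≤ (2 * C)⁻¹ * ‖v‖ ^ 2 :=
    (mul_le_mul_of_nonneg_left h2 hs.1).trans (by rw [← mul_assoc]; gcongr)
  have h5 : C⁻¹ = (2 * C)⁻¹ + (2 * C)⁻¹ := by field_simp; norm_num
  rw [sub_apply, smul_apply, inner_sub_right, inner_smul_right]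
  rw [h5, add_mul] at h1
  linarith

lemma fderiv_G_line {K : ℕ} (i : Fin N) (s : ℝ) {θ : Param D}
    (hg : ∀ m ≤ N, ContDiffAt ℝ (K + 1 : ℕ) (g m) θ) :
    HasFDerivAt (fun θ' => G g N θ' (ones N + s • looDir i))
      (fderiv ℝ (fun θ' => G g N θ' (ones N)) θ - s • fderiv ℝ (g ((i : ℕ) + 1)) θ) θ := by
  simp only [G_line]
  have hK : ((K + 1 : ℕ) : WithTop ℕ∞) ≠ 0 := by simp
  exact ((contDiffAt_G_left hg _).differentiableAt hK).hasFDerivAt.sub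
    (((hg _ i.2).differentiableAt hK).hasFDerivAt.const_smul s)

/-- The solution is smooth at the points of the segment from the all-ones vector to a leave-one-out
vector. -/
lemma contDiffAt_solution {K : ℕ} {θhat : Weight N → Param D} {C T₀ T₁ s : ℝ} {i : Fin N}
    {Θ : Set (Param D)} (hdom : DomainAssumption g θhat (loo i) Θ)
    (hsmooth : SmoothAssumption K N g Θ) (hconv : ConvexityAssumption N g Θ C) (hC : 0 < C)
    (hT₀ : ∀ θ ∈ Θ, ∀ j : Fin N, ‖g ((j : ℕ) + 1) θ‖ ≤ T₀)
    (hT₁ : ∀ θ ∈ Θ, ‖fderiv ℝ (g ((i : ℕ) + 1)) θ‖ ≤ T₁) (hN : 2 * C * T₁ ≤ N)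
    (hs : s ∈ Set.Icc 0 (1 / (N : ℝ))) :
    ContDiffAt ℝ (K + 1 : ℕ) θhat (ones N + s • looDir i) := by
  obtain ⟨ε, hε, h0, hsub⟩ := hdom.convexHull_subset
  have htube := tube_mem_nhds i hs hε
  set w := ones N + s • looDir i with hw
  have himg : ∀ w' ∈ tube (loo i) ε, θhat w' ∈ convexHull ℝ (θhat '' tube (loo i) ε) :=
    fun w' hw' => subset_convexHull ℝ _ ⟨w', hw', rfl⟩
  have hwt : w ∈ tube (loo i) ε := mem_of_mem_nhds htube
  have hg : ∀ θ ∈ Θ, ∀ m ≤ N, ContDiffAt ℝ (K + 1 : ℕ) (g m) θ :=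
    fun θ hθ m hm => hsmooth.contDiffAt hdom.1 hθ hm
  have hder : ∀ θ ∈ Θ, HasFDerivAt (fun θ' => G g N θ' w) _ θ :=
    fun θ hθ => fderiv_G_line i s (hg θ hθ)
  have hpos : ∀ θ ∈ Θ, _ := fun θ hθ => hconv.perturb hC i hT₁ hN hs hθ
  have hC2 : 0 < (2 * C)⁻¹ := by positivity
  -- Both solutions lie in the convex hull, so the segment between them stays in Θ and G(·, w) is
  -- strongly monotone on it. As G(θhat w, w) = 0 = G(θhat w', w'), the increment of G(·, w) equals
  -- G(θhat w', w) - G(θhat w', w'), which is linear in w - w'.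
  have hlip : ∀ w' ∈ tube (loo i) ε, ‖θhat w' - θhat w‖ ≤ 2 * C * (T₀ * ‖w - w'‖) := by
    intro w' hw'
    have hseg : segment ℝ (θhat w) (θhat w') ⊆ Θ :=
      ((convex_convexHull ℝ _).segment_subset (himg w hwt) (himg w' hw')).trans hsub
    have h1 := mul_norm_sub_le_of_segment (f := fun θ' => G g N θ' w) (c := (2 * C)⁻¹)
      (fun x hx => (hder x (hseg hx)).differentiableAt) fun x hx v => by
        rw [(hder x (hseg hx)).fderiv]; exact hpos x (hseg hx) v
    have h2 := norm_G_sub_G_le (hT₀ _ (hsub (himg w' hw'))) w w'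
    simp only [h0 w hwt, h0 w' hw'] at h1 h2
    exact (inv_mul_le_iff₀ (by positivity)).1 (h1.trans h2)
  have hcont : ContinuousAt θhat w := by
    rw [ContinuousAt, tendsto_iff_norm_sub_tendsto_zero]
    refine squeeze_zero' (Eventually.of_forall fun _ => norm_nonneg _)
      (mem_of_superset htube hlip) ?_
    have : Continuous fun w' : Weight N => 2 * C * (T₀ * ‖w - w'‖) := by fun_prop
    simpa using this.tendsto w
  have hΘ := hsub (himg w hwt)
  exact contDiffAt_of_implicit (Φ := fun p : Weight N × Param D => G g N p.2 p.1) (by simp)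
    (contDiffAt_G (hg _ hΘ) w) hcont (mem_of_superset htube h0) (hder _ hΘ)
    (norm_le_of_inner hC2 (hpos _ hΘ))

/-- The Taylor expansion of `θhat` along the segment to a leave-one-out vector. -/
lemma errIJ_loo_le {K : ℕ} {θhat : Weight N → Param D} {B : ℝ} {i : Fin N}
    (hθ : ∀ s ∈ Set.Icc 0 (1 / (N : ℝ)), ContDiffAt ℝ (K + 1 : ℕ) θhat (ones N + s • looDir i))
    (hB : ∀ s ∈ Set.Icc 0 (1 / (N : ℝ)),
      ‖iteratedFDeriv ℝ (K + 1) (fun s : ℝ => θhat (ones N + s • looDir i)) s‖ ≤ B) :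
    errIJ K θhat (loo i) ≤ B * (1 / (N : ℝ)) ^ (K + 1) / K.factorial := by
  have hN : (0 : ℝ) < N := by exact_mod_cast i.pos
  have hN1 : (0 : ℝ) < 1 / N := by positivity
  set ψ : ℝ → Param D := fun s => θhat (ones N + s • looDir i) with hψ
  have hline : ContDiff ℝ (K + 1 : ℕ) fun s : ℝ => ones N + s • looDir i := by fun_prop
  have hsmooth : ∀ s ∈ Set.Icc 0 (1 / (N : ℝ)), ContDiffAt ℝ (K + 1 : ℕ) ψ s :=
    fun s hs => (hθ s hs).comp s hline.contDiffAt
  have h0 : (0 : ℝ) ∈ Set.Icc 0 (1 / (N : ℝ)) := ⟨le_rfl, hN1.le⟩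
  have h1 : 1 / (N : ℝ) ∈ Set.Icc 0 (1 / (N : ℝ)) := ⟨hN1.le, le_rfl⟩
  have hwithin : ∀ k ≤ K + 1, ∀ s ∈ Set.Icc 0 (1 / (N : ℝ)),
      iteratedDerivWithin k ψ (Set.Icc 0 (1 / (N : ℝ))) s = iteratedDeriv k ψ s :=
    fun k hk s hs => iteratedDerivWithin_eq_iteratedDeriv (uniqueDiffOn_Icc hN1)
      ((hsmooth s hs).of_le (by exact_mod_cast hk)) hs
  have key := taylor_mean_remainder_bound (f := ψ) (n := K) (C := B) hN1.le
    (fun s hs => by exact_mod_cast (hsmooth s hs).contDiffWithinAt) h1 fun s hs => by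
      rw [hwithin _ le_rfl s hs, ← norm_iteratedFDeriv_eq_norm_iteratedDeriv]
      exact hB s hs
  have hend : ψ (1 / (N : ℝ)) = θhat (loo i) := by
    simp only [hψ, looDir, smul_smul]
    rw [one_div_mul_cancel hN.ne', one_smul, add_sub_cancel]
  have hterm : ∀ k ≤ K, ((k.factorial : ℝ)⁻¹ * (1 / (N : ℝ) - 0) ^ k) •
      iteratedDerivWithin k ψ (Set.Icc 0 (1 / (N : ℝ))) 0 =
      (1 / (k.factorial : ℝ)) • iteratedFDeriv ℝ k θhat (ones N) fun _ => loo i - ones N := by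
    intro k hk
    rw [hwithin k (by lia) 0 h0, hψ, iteratedDeriv_line _ _ _ _
      ((hθ 0 h0).of_le (by norm_cast; lia)), zero_smul, add_zero]
    -- Multilinearity extracts N ^ k, which cancels the (1/N) ^ k of the Taylor term.
    have : (fun _ : Fin k => looDir i) = fun _ : Fin k => (N : ℝ) • (loo i - ones N) := rfl
    rw [this, ContinuousMultilinearMap.map_smul_univ, smul_smul]
    congr 1
    simp only [Finset.prod_const, Finset.card_univ, Fintype.card_fin, sub_zero]
    rw [mul_assoc, ← mul_pow, one_div_mul_cancel hN.ne', one_pow, mul_one, one_div]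
  have hpoly : taylorWithinEval ψ K (Set.Icc 0 (1 / (N : ℝ))) 0 (1 / (N : ℝ)) =
      thetaIJ K θhat (loo i) := by
    rw [taylor_within_apply, Finset.sum_congr rfl fun k hk =>
      hterm k (Nat.lt_succ_iff.1 (Finset.mem_range.1 hk)), Finset.range_eq_Ico,
      Finset.sum_eq_sum_Ico_succ_bot (Nat.succ_pos K), thetaIJ]
    congr 1
    simp
  rw [hend, hpoly, norm_sub_rev, sub_zero] at key
  exact key

end LeaveOneOut

/-! ### Uniformity in N and the rate -/

section Rate

variable {D K : ℕ} {g : ℕ → Param D → Param D} {Θ : (N : ℕ) → Fin N → Set (Param D)}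

lemma SupTermsBounded.exists_norm_iteratedFDeriv_le (h : SupTermsBounded K g Θ) {k : ℕ}
    (hk : k ≤ K + 1) : ∃ T, ∀ (N : ℕ) (i : Fin N), ∀ θ ∈ Θ N i, ∀ j : Fin N,
      ‖iteratedFDeriv ℝ k (g ((j : ℕ) + 1)) θ‖ ≤ T := by
  obtain ⟨T, hT⟩ := h k hk
  exact ⟨_, fun N i θ hθ j =>
    norm_iteratedFDeriv_le_of_normInf (hT N i θ hθ _ (Nat.le_add_left 1 j) j.2)⟩

theorem errIJ_isBigO {θhat : (N : ℕ) → Weight N → Param D} (hsup : SupTermsBounded K g Θ)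
    (hassum : UniformAssumptions K g θhat Θ) :
    (∀ᶠ N : ℕ in atTop, ContDiffAt ℝ (K : WithTop ℕ∞) (θhat N) (ones N)) ∧
      (fun N : ℕ => ⨆ i : Fin N, errIJ K (θhat N) (loo i))
        =O[atTop] fun N : ℕ => (N : ℝ) ^ (-((K : ℤ) + 1)) := by
  obtain ⟨C, hC, M, hA⟩ := hassum
  obtain ⟨T₀, hT₀⟩ := hsup.exists_norm_iteratedFDeriv_le (Nat.zero_le _)
  obtain ⟨T₁, hT₁⟩ := hsup.exists_norm_iteratedFDeriv_le (Nat.le_add_left 1 K)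
  obtain ⟨N₀, hN₀⟩ := exists_nat_ge (2 * C * T₁)
  have hdom := fun (N : ℕ) (i : Fin N) => (hA N i.pos i).1
  have hsmooth := fun (N : ℕ) (i : Fin N) => (hA N i.pos i).2.1
  have hconv := fun (N : ℕ) (i : Fin N) => (hA N i.pos i).2.2.1
  have hbdd := fun (N : ℕ) (i : Fin N) => (hA N i.pos i).2.2.2
  have hT₀' : ∀ (N : ℕ) (i : Fin N), ∀ θ ∈ Θ N i, ∀ j : Fin N, ‖g ((j : ℕ) + 1) θ‖ ≤ T₀ :=
    fun N i θ hθ j => by simpa using hT₀ N i θ hθ j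
  have hT₁' : ∀ (N : ℕ) (i : Fin N), ∀ θ ∈ Θ N i, ‖fderiv ℝ (g ((i : ℕ) + 1)) θ‖ ≤ T₁ :=
    fun N i θ hθ => by simpa only [norm_iteratedFDeriv_one] using hT₁ N i θ hθ i
  have hreg : ∀ N, N₀ ≤ N → ∀ i : Fin N, ∀ s ∈ Set.Icc 0 (1 / (N : ℝ)),
      ContDiffAt ℝ (K + 1 : ℕ) (θhat N) (ones N + s • looDir i) := fun N hN i s hs =>
    contDiffAt_solution (hdom N i) (hsmooth N i) (hconv N i) hC (hT₀' N i) (hT₁' N i)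
      (hN₀.trans (by exact_mod_cast hN)) hs
  -- Indexing one family by N, the omitted datum and the point s makes the bound B below independent
  -- of all three.
  let ι := {p : (N : ℕ) × Fin N × ℝ // N₀ ≤ p.1 ∧ p.2.2 ∈ Set.Icc 0 (1 / (p.1 : ℝ))}
  let ψ : ι → ℝ → Param D := fun p s => θhat p.1.1 (ones p.1.1 + s • looDir p.1.2.1)
  let x : ι → ℝ := fun p => p.1.2.2
  have hmem : ∀ p : ι, ψ p (x p) ∈ Θ p.1.1 p.1.2.1 := fun p => by
    obtain ⟨ε, hε, -, hsub⟩ := (hdom _ p.1.2.1).convexHull_subset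
    exact hsub (subset_convexHull ℝ _ ⟨_, mem_of_mem_nhds (tube_mem_nhds _ p.2.2 hε), rfl⟩)
  have hg : ∀ p : ι, ∀ m ≤ p.1.1, ContDiffAt ℝ (K + 1 : ℕ) (g m) (ψ p (x p)) := fun p m hm =>
    (hsmooth _ p.1.2.1).contDiffAt (hdom _ _).1 (hmem p) hm
  let F : ι → Param D → Param D := fun p θ => G g p.1.1 θ (ones p.1.1)
  let h : ι → Param D → Param D := fun p => g ((p.1.2.1 : ℕ) + 1)
  have hF : UnifDerivBounded 1 (K + 1) F fun p => ψ p (x p) :=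
    ⟨fun p => contDiffAt_G_left (N := p.1.1) (hg p) (ones p.1.1), fun k h1 hk => ⟨_, fun p =>
      norm_iteratedFDeriv_le_of_norm2 (hbdd p.1.1 p.1.2.1 k h1 hk _ (hmem p))⟩⟩
  have hh : UnifDerivBounded 0 (K + 1) h fun p => ψ p (x p) := by
    refine ⟨fun p => hg p _ p.1.2.1.2, fun k _ hk => ?_⟩
    obtain ⟨T, hT⟩ := hsup.exists_norm_iteratedFDeriv_le hk
    exact ⟨T, fun p => hT _ p.1.2.1 _ (hmem p) p.1.2.1⟩
  have hψ : UnifDerivBounded 1 (K + 1) ψ x := by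
    refine UnifDerivBounded.of_implicit (C := (2 * C)⁻¹⁻¹) (R := 1) (fun p => ?_) hF hh
      (fun p => ?_) (fun p => ?_) fun p => ?_
    · have hline : ContDiff ℝ (K + 1 : ℕ) fun s : ℝ => ones p.1.1 + s • looDir p.1.2.1 := by
        fun_prop
      exact (hreg _ p.2.1 p.1.2.1 _ p.2.2).comp (x p) hline.contDiffAt
    · rw [abs_of_nonneg p.2.2.1]
      exact p.2.2.2.trans (div_le_one_of_le₀ (by exact_mod_cast p.1.2.1.pos) (by positivity))
    · obtain ⟨ε, hε, h0, -⟩ := (hdom _ p.1.2.1).convexHull_subset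
      have hline : Continuous fun s : ℝ => ones p.1.1 + s • looDir p.1.2.1 := by fun_prop
      filter_upwards [hline.continuousAt.eventually (tube_mem_nhds p.1.2.1 p.2.2 hε)] with s hs
      have := h0 _ hs
      rw [G_line] at this
      exact sub_eq_zero.1 this
    · exact norm_le_of_inner (by positivity) ((hconv _ p.1.2.1).perturb hC p.1.2.1 (hT₁' _ _)
        (hN₀.trans (by exact_mod_cast p.2.1)) p.2.2 (hmem p))
  obtain ⟨B, hB⟩ := hψ.2 (K + 1) (Nat.le_add_left 1 K) le_rfl
  refine ⟨?_, IsBigO.of_bound (B / K.factorial) ?_⟩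
  · filter_upwards [eventually_ge_atTop N₀, eventually_ge_atTop 1] with N hN h1
    -- At s = 0 every leave-one-out segment passes through 1_N, so any index serves; N ≥ 1 supplies
    -- one.
    have := hreg N hN ⟨0, h1⟩ 0 ⟨le_rfl, by positivity⟩
    rw [zero_smul, add_zero] at this
    exact this.of_le (by norm_cast; lia)
  · filter_upwards [eventually_ge_atTop N₀, eventually_ge_atTop 1] with N hN h1
    have : Nonempty (Fin N) := ⟨⟨0, h1⟩⟩
    have hnonneg : ∀ i : Fin N, 0 ≤ errIJ K (θhat N) (loo i) := fun i => norm_nonneg _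
    rw [Real.norm_of_nonneg (Real.iSup_nonneg hnonneg),
      Real.norm_of_nonneg (by positivity)]
    refine ciSup_le fun i => (errIJ_loo_le (hreg N hN i) fun s hs =>
      hB ⟨⟨N, i, s⟩, hN, hs⟩).trans (le_of_eq ?_)
    have : (N : ℝ) ^ (-((K : ℤ) + 1)) = (1 / (N : ℝ)) ^ (K + 1) := by
      rw [zpow_neg, one_div, inv_pow]
      norm_cast
    rw [this]
    ring

end Rate

end HOIJ

theorem mainTheorem8 {S : Type*} [MeasurableSpace S] (P : Measure S) [IsProbabilityMeasure P]
    (D K : ℕ)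
    (g : S → ℕ → HOIJ.Param D → HOIJ.Param D)
    (θhat : S → (N : ℕ) → HOIJ.Weight N → HOIJ.Param D)
    (Θ : S → (N : ℕ) → Fin N → Set (HOIJ.Param D))
    (hsup : ∀ᵐ s ∂P, HOIJ.SupTermsBounded K (g s) (Θ s))
    (hassum : ∀ᵐ s ∂P, HOIJ.UniformAssumptions K (g s) (θhat s) (Θ s)) :
    ∀ᵐ s ∂P,
      (∀ᶠ N : ℕ in atTop, ContDiffAt ℝ (K : WithTop ℕ∞) (θhat s N) (HOIJ.ones N)) ∧
      (fun N : ℕ => ⨆ i : Fin N, HOIJ.errIJ K (θhat s N) (HOIJ.loo i))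
        =O[atTop] fun N : ℕ => (N : ℝ) ^ (-((K : ℤ) + 1)) := by
  filter_upwards [hsup, hassum] with s h1 h2
  exact HOIJ.errIJ_isBigO h1 h2
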